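/- Let $\varphi(q)=\prod_{j\ge 1}(1-q^j)$ be Euler's product. For a positive integer $m$ and $k=(k_1,\dots,k_{4m-1})\in\mathbb Z^{4m-1}$ put $$\kappa(k)=\sum_{i=1}^{4m-1}k_i^2-\sum_{i=1}^{4m-2}k_ik_{i+1},$$ $$\mathrm{lin}(k)=(2m-1)k_1-k_2-\cdots-k_{3m-1}+(4m-2)k_{3m}-k_{3m+1}-\cdots-k_{4m-1}.$$ Then for every positive integer $m$ all the exponents $(4m-1)\kappa(k)+\mathrm{lin}(k)$ are non-negative, and $$\sum_{k\in\mathbb Z^{4m-1}}q^{(4m-1)\kappa(k)+\mathrm{lin}(k)}=\frac{\varphi(q^{4m-1})^{4m-1}\,\varphi(q^{2m})^2}{\varphi(q)\,\varphi(q^m)},$$ both as an identity of formal power series in $\mathbb C[[q]]$ (with coefficientwise convergence) and as an identity of complex numbers for every $q\in\mathbb C$ with $|q|<1$ (with absolute convergence). -/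

import Mathlib

open scoped PowerSeries.WithPiTopology

/-- Euler's product `φ(x) = ∏_{j ≥ 1} (1 - x ^ j)` in a topological commutative ring. It is used for
complex numbers `x` with `‖x‖ < 1` and for the formal power series `x = X ^ a` with `1 ≤ a`; the
product converges in both cases. -/
noncomputable def eulerPhi {R : Type*} [CommRing R] [TopologicalSpace R] (x : R) : R :=
  ∏' j : ℕ, (1 - x ^ (j + 1))

/-- The quadratic form `κ(k_1, …, k_l) = k_1² + ⋯ + k_l² - k_1 k_2 - ⋯ - k_{l-1} k_l`.
The variable `k_i` is `k ⟨i - 1, _⟩`. -/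
def kappa {l : ℕ} (k : Fin l → ℤ) : ℤ :=
  ∑ i : Fin l, k i ^ 2 -
    ∑ i : Fin (l - 1), k ⟨i.val, by omega⟩ * k ⟨i.val + 1, by omega⟩

/-- The coefficient of `k_{i+1}` in `lin`: it is `2m - 1` for `k_1`, `4m - 2` for `k_{3m}`
and `-1` for every other variable. -/
def linCoeff (m : ℕ) (i : Fin (4 * m - 1)) : ℤ :=
  if i.val + 1 = 1 then 2 * (m : ℤ) - 1
  else if i.val + 1 = 3 * m then 4 * (m : ℤ) - 2
  else -1

/-- The linear form `(2m-1) k_1 - k_2 - ⋯ - k_{3m-1} + (4m-2) k_{3m} - k_{3m+1} - ⋯ - k_{4m-1}`. -/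
def lin (m : ℕ) (k : Fin (4 * m - 1) → ℤ) : ℤ :=
  ∑ i : Fin (4 * m - 1), linCoeff m i * k i

/-- The exponent `(4m-1) κ(k) + lin(k)`. -/
def gaussExponent (m : ℕ) (k : Fin (4 * m - 1) → ℤ) : ℤ :=
  (4 * (m : ℤ) - 1) * kappa k + lin m k

open Filter Topology

/-!
Write `l = 4 * m - 1`. Multiplying Jacobi's triple products with base `q ^ l` and parameters
`w * q ^ j`, `0 ≤ j < l`, gives the theta series `∑ y, q ^ Q y * w ^ ∑ y` of a quadratic polynomial
`Q` on `ℤ ^ l` as `φ(q ^ l) ^ l` times the product side of the triple product with base `q`. The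
affine map `(y_0, …, y_{l-1}) ↦ (y_{l-1} + 1, y_0, …, y_{l-2})` raises `∑ y` by `1` and leaves
`Q y - tri (∑ y)` invariant, where `tri s = s (s - 1) / 2`, so the same series is the product of
`∑ s, q ^ tri s * w ^ s` with the theta series of `Q` on the lattice `∑ y = 0`; the latter is
therefore `φ(q ^ l) ^ l / φ(q)`.

In terms of the differences of consecutive `k_i`, cyclically shifted by `m`, the exponent of the
theorem is `Q y - tri s + m (2 s² - s)` with `s = ∑ y`. The sum over `k` thus factors into the
sum-zero theta series and `∑ s, (q ^ m) ^ (2 s² - s)`, which is `φ(q ^ (2 m)) ^ 2 / φ(q ^ m)` by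
Gauss's identity. Two formal power series with the same values on a punctured disc are equal, which
gives the formal identity.
-/

/-! ### Absolutely convergent sums -/

/-- The family `f` is absolutely summable with sum `a`. Absolute convergence is carried along
because products of series need it, and over a general complete normed field it does not follow
from `HasSum`. -/
structure HasAbsSum {ι E : Type*} [SeminormedAddCommGroup E] (f : ι → E) (a : E) : Prop where
  summable_norm : Summable fun i => ‖f i‖
  hasSum : HasSum f a

namespace HasAbsSum

section Group

variable {ι κ E : Type*} [SeminormedAddCommGroup E] {f : ι → E} {a : E}

theorem single (i : ι) (hf : ∀ j ≠ i, f j = 0) : HasAbsSum f (f i) where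
  summable_norm := (hasSum_single i fun j hj => by rw [hf j hj, norm_zero]).summable
  hasSum := hasSum_single i hf

theorem equiv_iff (e : κ ≃ ι) : HasAbsSum (f ∘ e) a ↔ HasAbsSum f a :=
  ⟨fun h => ⟨e.summable_iff.1 h.summable_norm, e.hasSum_iff.1 h.hasSum⟩,
    fun h => ⟨e.summable_iff.2 h.summable_norm, e.hasSum_iff.2 h.hasSum⟩⟩

theorem fiberwise {g : κ → E} (hf : HasAbsSum f a) (e : ι → κ)
    (hg : ∀ b, HasSum (fun i : {i // e i = b} => f i) (g b)) : HasAbsSum g a := by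
  have hnorm : Summable fun x : (b : κ) × {i // e i = b} => ‖f x.2‖ :=
    (Equiv.sigmaFiberEquiv e).summable_iff.2 hf.summable_norm
  have hsum : HasSum (fun x : (b : κ) × {i // e i = b} => f x.2) a :=
    (Equiv.sigmaFiberEquiv e).hasSum_iff.2 hf.hasSum
  refine ⟨hnorm.sigma.of_nonneg_of_le (fun _ => norm_nonneg _) fun b => ?_, ?_⟩
  · exact (hg b).norm_le_of_bounded (hnorm.sigma_factor b).hasSum fun _ => le_rfl
  · exact hsum.sigma hg

end Group

section Ring

variable {ι κ R : Type*}

theorem mul [NormedRing R] [CompleteSpace R] {f : ι → R} {g : κ → R} {a b : R}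
    (hf : HasAbsSum f a) (hg : HasAbsSum g b) :
    HasAbsSum (fun x : ι × κ => f x.1 * g x.2) (a * b) :=
  have h := hf.summable_norm.mul_norm hg.summable_norm
  ⟨h, hf.hasSum.mul hg.hasSum h.of_norm⟩

theorem prod_pi [NormedCommRing R] [CompleteSpace R] {n : ℕ} {κ : Fin n → Type*}
    {f : ∀ j, κ j → R} {a : Fin n → R} (hf : ∀ j, HasAbsSum (f j) (a j)) :
    HasAbsSum (fun y : ∀ j, κ j => ∏ j, f j (y j)) (∏ j, a j) := by
  induction n with
  | zero => exact ⟨(hasSum_fintype _).summable, by simp⟩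
  | succ n ih =>
    rw [← equiv_iff (Fin.consEquiv κ), Fin.prod_univ_succ]
    convert (hf 0).mul (ih fun j => hf j.succ) using 2 with x
    simp [Fin.prod_univ_succ]

end Ring

end HasAbsSum

/-! ### Triangular numbers and `q`-binomial coefficients -/

/-- The triangular number `y (y - 1) / 2` of an integer `y`, the exponent of `p` in the theta series
`∑ p ^ tri y * w ^ y`; the division is exact. -/
def tri (y : ℤ) : ℤ := y * (y - 1) / 2

theorem two_mul_tri (y : ℤ) : 2 * tri y = y * (y - 1) :=
  Int.mul_ediv_cancel' (Int.even_mul_pred_self y).two_dvd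

theorem tri_add_one (y : ℤ) : tri (y + 1) = tri y + y := by
  linarith [two_mul_tri (y + 1), two_mul_tri y]

theorem tri_neg (y : ℤ) : tri (-y) = tri y + y := by
  linarith [two_mul_tri (-y), two_mul_tri y]

theorem tri_nonneg (y : ℤ) : 0 ≤ tri y := by
  have h := two_mul_tri y
  rcases le_or_gt y 0 with h0 | h0 <;> nlinarith

theorem zpow_tri_neg_mul_zpow_neg {K : Type*} [Field K] {p : K} (hp : p ≠ 0) (w : K) (y : ℤ) :
    p ^ tri (-y) * w ^ (-y) = p ^ tri y * (p * w⁻¹) ^ y := by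
  rw [tri_neg, zpow_add₀ hp, mul_zpow, inv_zpow', mul_assoc]

section QBinomial

variable {K : Type*} [Field K] {p : K}

/-- The finite `q`-Pochhammer symbol `(p; p)_n = (1 - p) ⋯ (1 - p ^ n)`. -/
def qPoch (p : K) (n : ℕ) : K := ∏ j ∈ Finset.range n, (1 - p ^ (j + 1))

/-- The reciprocal of `(p; p)_n`. It is `0` for negative `n`, which makes `qPochInv_sub_one` hold
for all integers. -/
def qPochInv (p : K) (n : ℤ) : K := if n < 0 then 0 else (qPoch p n.toNat)⁻¹

theorem one_sub_pow_succ_ne_zero (hp : ¬IsOfFinOrder p) (n : ℕ) : 1 - p ^ (n + 1) ≠ 0 := fun h =>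
  hp (isOfFinOrder_iff_pow_eq_one.2 ⟨n + 1, n.succ_pos, (sub_eq_zero.1 h).symm⟩)

theorem qPoch_succ (p : K) (n : ℕ) : qPoch p (n + 1) = qPoch p n * (1 - p ^ (n + 1)) :=
  Finset.prod_range_succ _ _

theorem qPochInv_natCast (p : K) (n : ℕ) : qPochInv p n = (qPoch p n)⁻¹ := by
  simp [qPochInv]

theorem qPochInv_of_neg (p : K) {n : ℤ} (hn : n < 0) : qPochInv p n = 0 := if_pos hn

theorem qPochInv_sub_one (hp : ¬IsOfFinOrder p) (n : ℤ) :
    qPochInv p (n - 1) = (1 - p ^ n) * qPochInv p n := by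
  rcases lt_trichotomy n 0 with hn | rfl | hn
  · rw [qPochInv_of_neg p hn, qPochInv_of_neg p (by lia), mul_zero]
  · rw [qPochInv_of_neg p (by lia), zpow_zero, sub_self, zero_mul]
  · obtain ⟨k, rfl⟩ : ∃ k : ℕ, n = (k + 1 : ℕ) := ⟨n.toNat - 1, by lia⟩
    have hk := one_sub_pow_succ_ne_zero hp k
    rw [Nat.cast_succ, add_sub_cancel_right, ← Nat.cast_succ, qPochInv_natCast, qPochInv_natCast,
      zpow_natCast, qPoch_succ, mul_inv, mul_left_comm, mul_inv_cancel₀ hk, mul_one]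

/-- The Gaussian binomial coefficient `[M + N choose M - y]`. It vanishes unless `-N ≤ y ≤ M`. -/
def qBinom (p : K) (M N : ℕ) (y : ℤ) : K :=
  qPoch p (M + N) * qPochInv p (M - y) * qPochInv p (N + y)

theorem qBinom_neg (p : K) (M N : ℕ) (y : ℤ) : qBinom p M N (-y) = qBinom p N M y := by
  rw [qBinom, qBinom, sub_neg_eq_add, ← sub_eq_add_neg, add_comm M N, mul_right_comm]

theorem qBinom_zero_zero (p : K) (y : ℤ) : qBinom p 0 0 y = if y = 0 then 1 else 0 := by
  rcases lt_trichotomy y 0 with hy | rfl | hy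
  · simp [qBinom, qPochInv_of_neg, hy, hy.ne]
  · simp [qBinom, qPochInv, qPoch]
  · simp [qBinom, qPochInv_of_neg, hy, hy.ne']

theorem qBinom_succ_left (hp0 : p ≠ 0) (hp : ¬IsOfFinOrder p) (M N : ℕ) (y : ℤ) :
    qBinom p (M + 1) N y = qBinom p M N y + p ^ ((M : ℤ) + 1 - y) * qBinom p M N (y - 1) := by
  have hM : qPochInv p (M - y) =
      (1 - p ^ ((M : ℤ) + 1 - y)) * qPochInv p ((M : ℤ) + 1 - y) := by
    rw [← qPochInv_sub_one hp]
    ring_nf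
  have hN : qPochInv p (N + (y - 1)) = (1 - p ^ ((N : ℤ) + y)) * qPochInv p (N + y) := by
    rw [← qPochInv_sub_one hp]
    ring_nf
  have hpow : p ^ ((M : ℤ) + 1 - y) * p ^ ((N : ℤ) + y) = p ^ (M + N + 1) := by
    rw [← zpow_add₀ hp0, ← zpow_natCast]
    push_cast
    ring_nf
  rw [qBinom, qBinom, qBinom, hM, hN, add_right_comm, qPoch_succ, ← hpow,
    show (M : ℤ) - (y - 1) = M + 1 - y by ring]
  push_cast
  ring

theorem qBinom_succ_left_mul (hp0 : p ≠ 0) (hp : ¬IsOfFinOrder p) {w : K} (hw : w ≠ 0)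
    (M N : ℕ) (y : ℤ) :
    qBinom p (M + 1) N y * (p ^ tri y * w ^ y) = qBinom p M N y * (p ^ tri y * w ^ y) +
      w * p ^ M * (qBinom p M N (y - 1) * (p ^ tri (y - 1) * w ^ (y - 1))) := by
  have htri : tri y + (M + 1 - y) = M + tri (y - 1) := by
    have := tri_add_one (y - 1)
    rw [sub_add_cancel] at this
    lia
  have hpow : p ^ tri y * p ^ ((M : ℤ) + 1 - y) = p ^ M * p ^ tri (y - 1) := by
    rw [← zpow_add₀ hp0, htri, zpow_add₀ hp0, zpow_natCast]
  have hwpow : w ^ y = w * w ^ (y - 1) := by rw [← zpow_one_add₀ hw, add_sub_cancel]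
  rw [qBinom_succ_left hp0 hp]
  linear_combination (qBinom p M N (y - 1) * w ^ y) * hpow +
    (qBinom p M N (y - 1) * p ^ M * p ^ tri (y - 1)) * hwpow

variable [TopologicalSpace K] [IsTopologicalSemiring K]

theorem hasSum_qBinom_of_left_zero (hp0 : p ≠ 0) (hp : ¬IsOfFinOrder p) {w : K} (hw : w ≠ 0)
    {N : ℕ} {c : K} (hc : HasSum (fun y => qBinom p 0 N y * (p ^ tri y * w ^ y)) c) (M : ℕ) :
    HasSum (fun y => qBinom p M N y * (p ^ tri y * w ^ y))
      ((∏ k ∈ Finset.range M, (1 + w * p ^ k)) * c) := by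
  induction M with
  | zero => simpa using hc
  | succ M ih =>
    have hshift := ((Equiv.subRight (1 : ℤ)).hasSum_iff.2 ih).mul_left (w * p ^ M)
    rw [Finset.prod_range_succ, mul_right_comm, mul_one_add, mul_comm _ (w * p ^ M)]
    exact (ih.add hshift).congr_fun (qBinom_succ_left_mul hp0 hp hw M N)

theorem hasSum_finite_tripleProduct (hp0 : p ≠ 0) (hp : ¬IsOfFinOrder p) {w : K} (hw : w ≠ 0)
    (M N : ℕ) : HasSum (fun y => qBinom p M N y * (p ^ tri y * w ^ y))
      ((∏ k ∈ Finset.range M, (1 + w * p ^ k)) * ∏ k ∈ Finset.range N, (1 + p * w⁻¹ * p ^ k)) := by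
  have hzero : HasSum (fun y => qBinom p 0 0 y * (p ^ tri y * (p * w⁻¹) ^ y)) 1 :=
    (hasSum_ite_eq (0 : ℤ) (1 : K)).congr_fun fun y => by
      rw [qBinom_zero_zero]
      split_ifs with hy <;> simp [hy, tri]
  have hright := hasSum_qBinom_of_left_zero hp0 hp (mul_ne_zero hp0 (inv_ne_zero hw)) hzero N
  rw [mul_one, ← (Equiv.neg ℤ).hasSum_iff] at hright
  refine hasSum_qBinom_of_left_zero hp0 hp hw (hright.congr_fun fun y => ?_) M
  rw [Function.comp_apply, Equiv.neg_apply, qBinom_neg, zpow_tri_neg_mul_zpow_neg hp0, mul_inv,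
    inv_inv, mul_inv_cancel_left₀ hp0]

end QBinomial

/-! ### Infinite products -/

section InfiniteProducts

variable {𝕜 : Type*} [NormedField 𝕜] {p q : 𝕜}

/-- The infinite product `(-w; p)_∞ = ∏_{k ≥ 0} (1 + w p ^ k)`; the sign of `w` is the one which
occurs in the triple product identity. -/
noncomputable def qProd (p w : 𝕜) : 𝕜 := ∏' k : ℕ, (1 + w * p ^ k)

theorem not_isOfFinOrder_of_norm_lt_one (hp : ‖p‖ < 1) : ¬IsOfFinOrder p := fun h =>
  hp.ne h.norm_eq_one

theorem norm_pow_lt_one (hq : ‖q‖ < 1) {n : ℕ} (hn : n ≠ 0) : ‖q ^ n‖ < 1 := by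
  rw [norm_pow]
  exact pow_lt_one₀ (norm_nonneg q) hq hn

theorem summable_norm_mul_pow (hp : ‖p‖ < 1) (w : 𝕜) : Summable fun k : ℕ => ‖w * p ^ k‖ := by
  simp_rw [norm_mul, norm_pow]
  exact (summable_geometric_of_lt_one (norm_nonneg p) hp).mul_left _

theorem eulerPhi_eq_qProd (p : 𝕜) : eulerPhi p = qProd p (-p) :=
  tprod_congr fun k => by rw [pow_succ', neg_mul, sub_eq_add_neg]

variable [CompleteSpace 𝕜]

theorem hasProd_qProd (hp : ‖p‖ < 1) (w : 𝕜) : HasProd (fun k : ℕ => 1 + w * p ^ k) (qProd p w) :=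
  (multipliable_one_add_of_summable (summable_norm_mul_pow hp w)).hasProd

theorem qProd_ne_zero (hp : ‖p‖ < 1) {w : 𝕜} (hw : ∀ k : ℕ, 1 + w * p ^ k ≠ 0) : qProd p w ≠ 0 :=
  tprod_one_add_ne_zero_of_summable hw (summable_norm_mul_pow hp w)

theorem eulerPhi_ne_zero (hp : ‖p‖ < 1) : eulerPhi p ≠ 0 := by
  rw [eulerPhi_eq_qProd]
  refine qProd_ne_zero hp fun k => ?_
  rw [neg_mul, ← sub_eq_add_neg, ← pow_succ']
  exact one_sub_pow_succ_ne_zero (not_isOfFinOrder_of_norm_lt_one hp) k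

theorem tendsto_qPoch (hp : ‖p‖ < 1) : Tendsto (qPoch p) atTop (𝓝 (eulerPhi p)) := by
  rw [eulerPhi_eq_qProd]
  refine (hasProd_qProd hp (-p)).tendsto_prod_nat.congr fun n => ?_
  exact Finset.prod_congr rfl fun k _ => by rw [pow_succ', neg_mul, sub_eq_add_neg]

theorem prod_qProd_pow_left (hq : ‖q‖ < 1) (w : 𝕜) (l : ℕ) [NeZero l] :
    ∏ j : Fin l, qProd (q ^ l) (w * q ^ (j : ℕ)) = qProd q w := by
  have hfiber (j : Fin l) : HasProd (fun i : ℕ => 1 + w * q ^ (i * l + j))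
      (qProd (q ^ l) (w * q ^ (j : ℕ))) :=
    (hasProd_qProd (norm_pow_lt_one hq (NeZero.ne l)) _).congr_fun fun i => by
      rw [pow_add, pow_mul', mul_assoc, mul_comm (q ^ (j : ℕ))]
  have hprod := ((Nat.divModEquiv l).trans (Equiv.prodComm _ _)).symm.hasProd_iff.2
    (hasProd_qProd hq w)
  exact (hasProd_fintype _).unique (hprod.prod_fiberwise hfiber)

theorem prod_qProd_pow_mul_inv (hq : ‖q‖ < 1) (hq0 : q ≠ 0) (w : 𝕜) (l : ℕ) [NeZero l] :
    ∏ j : Fin l, qProd (q ^ l) (q ^ l * (w * q ^ (j : ℕ))⁻¹) = qProd q (q * w⁻¹) := by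
  rw [← prod_qProd_pow_left hq (q * w⁻¹) l, ← Equiv.prod_comp Fin.revPerm]
  refine Finset.prod_congr rfl fun j _ => congrArg _ ?_
  have hpow : q ^ l = q * q ^ (j : ℕ) * q ^ ((Fin.rev j : Fin l) : ℕ) := by
    rw [← pow_succ', ← pow_add, Fin.val_rev]
    congr 1
    lia
  rw [Fin.revPerm_apply, hpow, mul_inv]
  field_simp

theorem qProd_self_mul_eulerPhi (hq : ‖q‖ < 1) : qProd q q * eulerPhi q = eulerPhi (q ^ 2) := by
  rw [eulerPhi_eq_qProd, eulerPhi_eq_qProd]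
  refine ((hasProd_qProd hq q).mul (hasProd_qProd hq (-q))).unique ?_
  refine (hasProd_qProd (norm_pow_lt_one hq two_ne_zero) (-q ^ 2)).congr_fun fun k => ?_
  ring

end InfiniteProducts

/-! ### Jacobi's triple product and Gauss's identity -/

section TripleProduct

variable {𝕜 : Type*} [NormedField 𝕜] {p q w : 𝕜}

theorem summable_norm_pow_tri_mul_pow (hp0 : p ≠ 0) (hp : ‖p‖ < 1) (hw : w ≠ 0) :
    Summable fun n : ℕ => ‖p ^ tri n * w ^ n‖ := by
  have hne (n : ℕ) : ‖p ^ tri n * w ^ n‖ ≠ 0 :=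
    norm_ne_zero_iff.2 (mul_ne_zero (zpow_ne_zero _ hp0) (pow_ne_zero _ hw))
  have hratio (n : ℕ) :
      ‖‖p ^ tri (n + 1 : ℕ) * w ^ (n + 1)‖‖ / ‖‖p ^ tri n * w ^ n‖‖ = ‖p‖ ^ n * ‖w‖ := by
    rw [norm_norm, norm_norm, div_eq_iff (hne n), Nat.cast_succ, tri_add_one, zpow_add₀ hp0,
      zpow_natCast, pow_succ]
    simp only [norm_mul, norm_pow]
    ring
  refine summable_of_ratio_test_tendsto_lt_one zero_lt_one (Eventually.of_forall hne) ?_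
  simp_rw [hratio]
  simpa using (tendsto_pow_atTop_nhds_zero_of_lt_one (norm_nonneg p) hp).mul_const ‖w‖

theorem summable_norm_zpow_tri_mul_zpow (hp0 : p ≠ 0) (hp : ‖p‖ < 1) (hw : w ≠ 0) :
    Summable fun y : ℤ => ‖p ^ tri y * w ^ y‖ := by
  refine Summable.of_nat_of_neg ?_ ?_
  · simpa using summable_norm_pow_tri_mul_pow hp0 hp hw
  · simp_rw [zpow_tri_neg_mul_zpow_neg hp0]
    simpa using summable_norm_pow_tri_mul_pow hp0 hp (mul_ne_zero hp0 (inv_ne_zero hw))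

variable [CompleteSpace 𝕜]

theorem tendsto_qPochInv (hp : ‖p‖ < 1) : Tendsto (qPochInv p) atTop (𝓝 (eulerPhi p)⁻¹) := by
  have hnat : Tendsto (fun n : ℕ => qPochInv p n) atTop (𝓝 (eulerPhi p)⁻¹) :=
    ((tendsto_qPoch hp).inv₀ (eulerPhi_ne_zero hp)).congr fun n => (qPochInv_natCast p n).symm
  rwa [← Nat.map_cast_int_atTop, tendsto_map'_iff]

theorem exists_norm_qPochInv_le (hp : ‖p‖ < 1) : ∃ C : ℝ, ∀ n, ‖qPochInv p n‖ ≤ C := by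
  obtain ⟨C, hC⟩ := ((tendsto_qPoch hp).inv₀ (eulerPhi_ne_zero hp)).norm.bddAbove_range
  have hnat (n : ℕ) : ‖qPochInv p n‖ ≤ C := by
    rw [qPochInv_natCast]
    exact hC ⟨n, rfl⟩
  refine ⟨C, fun n => ?_⟩
  rcases lt_or_ge n 0 with hn | hn
  · rw [qPochInv_of_neg p hn, norm_zero]
    exact (norm_nonneg _).trans (hnat 0)
  · lift n to ℕ using hn
    exact hnat n

theorem tendsto_qBinom (hp : ‖p‖ < 1) (y : ℤ) :
    Tendsto (fun N : ℕ => qBinom p N N y) atTop (𝓝 (eulerPhi p)⁻¹) := by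
  have hpoch : Tendsto (fun N : ℕ => qPoch p (N + N)) atTop (𝓝 (eulerPhi p)) :=
    (tendsto_qPoch hp).comp (tendsto_id.atTop_add_nonneg fun _ => zero_le)
  have hinv (z : ℤ) : Tendsto (fun N : ℕ => qPochInv p (N + z)) atTop (𝓝 (eulerPhi p)⁻¹) :=
    (tendsto_qPochInv hp).comp (tendsto_atTop_add_const_right _ z tendsto_natCast_atTop_atTop)
  simpa [qBinom, sub_eq_add_neg, eulerPhi_ne_zero hp] using (hpoch.mul (hinv (-y))).mul (hinv y)

theorem exists_norm_qBinom_le (hp : ‖p‖ < 1) : ∃ C : ℝ, ∀ M N y, ‖qBinom p M N y‖ ≤ C := by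
  obtain ⟨A, hA⟩ := (tendsto_qPoch hp).norm.bddAbove_range
  obtain ⟨B, hB⟩ := exists_norm_qPochInv_le hp
  have hA' (n : ℕ) : ‖qPoch p n‖ ≤ A := hA ⟨n, rfl⟩
  have hA0 : 0 ≤ A := (norm_nonneg _).trans (hA' 0)
  have hB0 : 0 ≤ B := (norm_nonneg _).trans (hB 0)
  refine ⟨A * B * B, fun M N y => ?_⟩
  rw [qBinom, norm_mul, norm_mul]
  gcongr
  exacts [hA' _, hB _, hB _]

theorem hasAbsSum_tripleProduct (hp0 : p ≠ 0) (hp : ‖p‖ < 1) (hw : w ≠ 0) :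
    HasAbsSum (fun y : ℤ => p ^ tri y * w ^ y)
      (eulerPhi p * (qProd p w * qProd p (p * w⁻¹))) := by
  have hsummable := summable_norm_zpow_tri_mul_zpow hp0 hp hw
  obtain ⟨C, hC⟩ := exists_norm_qBinom_le hp
  have hlim : Tendsto (fun N : ℕ => ∑' y, qBinom p N N y * (p ^ tri y * w ^ y)) atTop
      (𝓝 (∑' y : ℤ, (eulerPhi p)⁻¹ * (p ^ tri y * w ^ y))) := by
    refine tendsto_tsum_of_dominated_convergence (hsummable.mul_left C)
      (fun y => (tendsto_qBinom hp y).mul_const _) (Eventually.of_forall fun N y => ?_)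
    rw [norm_mul]
    gcongr
    exact hC N N y
  have hprod := (hasProd_qProd hp w).tendsto_prod_nat.mul
    (hasProd_qProd hp (p * w⁻¹)).tendsto_prod_nat
  have heq := tendsto_nhds_unique (hlim.congr fun N =>
    (hasSum_finite_tripleProduct hp0 (not_isOfFinOrder_of_norm_lt_one hp) hw N N).tsum_eq) hprod
  rw [tsum_mul_left] at heq
  refine ⟨hsummable, ?_⟩
  rw [← heq, mul_inv_cancel_left₀ (eulerPhi_ne_zero hp)]
  exact hsummable.of_norm.hasSum

theorem qProd_sq_mul_qProd_sq (hq : ‖q‖ < 1) (w : 𝕜) :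
    qProd (q ^ 2) w * qProd (q ^ 2) (w * q) = qProd q w := by
  simpa [Fin.prod_univ_two] using prod_qProd_pow_left hq w 2

/-- Gauss's identity is Jacobi's for `p = q ^ 4` and `w = q`, because `4 * tri s + s = 2 s² - s`. -/
theorem hasAbsSum_gauss (hq0 : q ≠ 0) (hq : ‖q‖ < 1) :
    HasAbsSum (fun s : ℤ => q ^ (2 * s ^ 2 - s)) (eulerPhi (q ^ 2) ^ 2 / eulerPhi q) := by
  have hq2 := norm_pow_lt_one hq two_ne_zero
  have htriple := hasAbsSum_tripleProduct (pow_ne_zero 4 hq0) (norm_pow_lt_one hq four_ne_zero) hq0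
  have hterm (s : ℤ) : (q ^ 4) ^ tri s * q ^ s = q ^ (2 * s ^ 2 - s) := by
    rw [← zpow_natCast, ← zpow_mul, ← zpow_add₀ hq0]
    congr 1
    linear_combination 2 * two_mul_tri s
  have hodd : qProd (q ^ 4) q * qProd (q ^ 4) (q ^ 4 * q⁻¹) = qProd (q ^ 2) q := by
    rw [← qProd_sq_mul_qProd_sq hq2, ← pow_mul, ← pow_succ', pow_succ q 3,
      mul_inv_cancel_right₀ hq0]
  have hdouble : qProd (q ^ 2) (q ^ 2) * eulerPhi (q ^ 2) = eulerPhi (q ^ 4) := by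
    rw [qProd_self_mul_eulerPhi hq2, ← pow_mul]
  have hsplit : qProd (q ^ 2) q * qProd (q ^ 2) (q ^ 2) = qProd q q := by
    rw [← qProd_sq_mul_qProd_sq hq, ← pow_two]
  have hvalue : eulerPhi (q ^ 4) * (qProd (q ^ 4) q * qProd (q ^ 4) (q ^ 4 * q⁻¹)) =
      eulerPhi (q ^ 2) ^ 2 / eulerPhi q := by
    rw [eq_div_iff (eulerPhi_ne_zero hq), hodd, ← hdouble]
    linear_combination eulerPhi (q ^ 2) * eulerPhi q * hsplit +
      eulerPhi (q ^ 2) * qProd_self_mul_eulerPhi hq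
  rw [← hvalue, ← funext hterm]
  exact htriple

end TripleProduct

/-! ### Theta series of a lattice and of its sum-zero sublattice -/

theorem zpow_sum₀ {ι K : Type*} [Field K] {q : K} (hq : q ≠ 0) (s : Finset ι) (f : ι → ℤ) :
    q ^ ∑ i ∈ s, f i = ∏ i ∈ s, q ^ f i := by
  classical
  induction s using Finset.induction_on with
  | empty => simp
  | insert i s hi ih => rw [Finset.sum_insert hi, Finset.prod_insert hi, zpow_add₀ hq, ih]

/-- The inhomogeneous quadratic form `∑ j, (l * tri (y j) + j * y j)`. Its theta series is a product
of `l` triple products, one for each residue class modulo `l`. -/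
def residueForm (l : ℕ) (y : Fin l → ℤ) : ℤ := ∑ j, ((l : ℤ) * tri (y j) + (j : ℕ) * y j)

theorem mul_tri_add_mul_nonneg {a b : ℤ} (hb : 0 ≤ b) (hba : b ≤ a) (x : ℤ) :
    0 ≤ a * tri x + b * x := by
  rcases le_total 0 x with hx | hx
  · exact add_nonneg (mul_nonneg (hb.trans hba) (tri_nonneg x)) (mul_nonneg hb hx)
  · have htri : -x ≤ tri x := by linarith [tri_neg x, tri_nonneg (-x)]
    nlinarith [mul_le_mul_of_nonneg_left htri (hb.trans hba)]

theorem residueForm_nonneg {l : ℕ} (y : Fin l → ℤ) : 0 ≤ residueForm l y :=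
  Finset.sum_nonneg fun j _ =>
    mul_tri_add_mul_nonneg (Int.natCast_nonneg _) (by exact_mod_cast j.2.le) (y j)

section ResidueTheta

variable {𝕜 : Type*} [NormedField 𝕜] [CompleteSpace 𝕜] {q w : 𝕜}

theorem hasAbsSum_residueForm (hq0 : q ≠ 0) (hq : ‖q‖ < 1) (hw : w ≠ 0) (l : ℕ) [NeZero l] :
    HasAbsSum (fun y : Fin l → ℤ => q ^ residueForm l y * w ^ ∑ j, y j)
      (eulerPhi (q ^ l) ^ l * (qProd q w * qProd q (q * w⁻¹))) := by
  have hprod := HasAbsSum.prod_pi fun j : Fin l =>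
    hasAbsSum_tripleProduct (pow_ne_zero l hq0) (norm_pow_lt_one hq (NeZero.ne l))
      (mul_ne_zero hw (pow_ne_zero (j : ℕ) hq0))
  rw [Finset.prod_mul_distrib, Finset.prod_mul_distrib, prod_qProd_pow_left hq,
    prod_qProd_pow_mul_inv hq hq0, Finset.prod_const, Finset.card_univ, Fintype.card_fin] at hprod
  convert hprod using 2 with y
  rw [residueForm, zpow_sum₀ hq0, zpow_sum₀ hw, ← Finset.prod_mul_distrib]
  refine Finset.prod_congr rfl fun j _ => ?_
  rw [zpow_add₀ hq0, mul_zpow, zpow_mul, zpow_mul, zpow_natCast, zpow_natCast, mul_assoc,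
    mul_comm (w ^ y j)]

end ResidueTheta

theorem perm_zpow_apply_eq_add {α : Type*} (σ : Equiv.Perm α) {f : α → ℤ} {c : ℤ}
    (h : ∀ x, f (σ x) = f x + c) (s : ℤ) (x : α) : f ((σ ^ s) x) = f x + s * c := by
  induction s using Int.induction_on generalizing x with
  | zero => simp
  | succ n ih =>
    rw [zpow_add, zpow_one, Equiv.Perm.mul_apply, ih, h]
    ring
  | pred n ih =>
    have hx := h (σ⁻¹ x)
    rw [← Equiv.Perm.mul_apply, mul_inv_cancel, Equiv.Perm.one_apply] at hx
    rw [zpow_sub, zpow_one, Equiv.Perm.mul_apply, ih, hx]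
    ring

section AffineRotation

variable {l : ℕ} [NeZero l]

theorem fin_val_add_one_eq_mod (j : Fin l) : ((j + 1 : Fin l) : ℕ) = (j + 1) % l := by
  rw [Fin.val_add, Fin.val_one', Nat.add_mod_mod]

variable (l) in
/-- The affine rotation `(y_0, …, y_{l-1}) ↦ (y_{l-1} + 1, y_0, …, y_{l-2})`. It increases the sum
of the coordinates by `1`, so that its powers identify the hyperplanes `∑ y = s`. -/
def affineRotate : Equiv.Perm (Fin l → ℤ) where
  toFun y i := y (i - 1) + if i = 0 then 1 else 0
  invFun z i := z (i + 1) - if i + 1 = 0 then 1 else 0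
  left_inv y := by simp
  right_inv z := by simp

theorem affineRotate_apply (y : Fin l → ℤ) (i : Fin l) :
    affineRotate l y i = y (i - 1) + if i = 0 then 1 else 0 := rfl

theorem sum_affineRotate (y : Fin l → ℤ) : ∑ j, affineRotate l y j = ∑ j, y j + 1 := by
  simp only [affineRotate_apply, Finset.sum_add_distrib, Finset.sum_ite_eq', Finset.mem_univ,
    if_true]
  exact congrArg (· + 1) ((Equiv.subRight (1 : Fin l)).sum_comp y)

theorem residueForm_affineRotate (y : Fin l → ℤ) :
    residueForm l (affineRotate l y) = residueForm l y + ∑ j, y j := by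
  rw [residueForm, residueForm, ← Finset.sum_add_distrib]
  refine (Equiv.sum_comp (Equiv.addRight (1 : Fin l)) _).symm.trans
    (Finset.sum_congr rfl fun j _ => ?_)
  simp only [Equiv.coe_addRight, affineRotate_apply, add_sub_cancel_right, ← Fin.val_eq_zero_iff,
    fin_val_add_one_eq_mod]
  rcases (Nat.succ_le_of_lt j.2).eq_or_lt with hj | hj
  · have hcast : (j : ℤ) + 1 = l := by exact_mod_cast hj
    rw [← Nat.succ_eq_add_one, hj, Nat.mod_self, if_pos rfl, tri_add_one, ← hcast]
    push_cast
    ring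
  · rw [Nat.mod_eq_of_lt hj, if_neg j.val.succ_ne_zero, add_zero]
    push_cast
    ring

theorem sum_affineRotate_zpow (s : ℤ) (y : Fin l → ℤ) :
    ∑ j, (affineRotate l ^ s) y j = ∑ j, y j + s := by
  simpa using perm_zpow_apply_eq_add (affineRotate l) sum_affineRotate s y

theorem residueForm_sub_tri_affineRotate_zpow (s : ℤ) (y : Fin l → ℤ) :
    residueForm l ((affineRotate l ^ s) y) - tri (∑ j, (affineRotate l ^ s) y j) =
      residueForm l y - tri (∑ j, y j) := by
  refine (perm_zpow_apply_eq_add (affineRotate l)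
    (f := fun y => residueForm l y - tri (∑ j, y j)) (c := 0) (fun y => ?_) s y).trans (by simp)
  rw [residueForm_affineRotate, sum_affineRotate, tri_add_one]
  ring

variable (l) in
/-- The point with affine coordinates `(s, y)` is the `s`-th affine rotation of `y`; its coordinates
add up to `s`. -/
def sumZeroEquiv : ℤ × {y : Fin l → ℤ // ∑ j, y j = 0} ≃ (Fin l → ℤ) where
  toFun x := (affineRotate l ^ x.1) x.2
  invFun y := (∑ j, y j, ⟨(affineRotate l ^ (-∑ j, y j)) y, by
    rw [sum_affineRotate_zpow, add_neg_cancel]⟩)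
  left_inv := fun ⟨s, y, hy⟩ => by
    have hsum : ∑ j, (affineRotate l ^ s) y j = s := by rw [sum_affineRotate_zpow, hy, zero_add]
    ext1
    · exact hsum
    · refine Subtype.ext ?_
      simp only [hsum]
      rw [← Equiv.Perm.mul_apply, ← zpow_add, neg_add_cancel, zpow_zero, Equiv.Perm.one_apply]
  right_inv y := by
    dsimp only
    rw [← Equiv.Perm.mul_apply, ← zpow_add, add_neg_cancel, zpow_zero, Equiv.Perm.one_apply]

theorem sum_sumZeroEquiv (x : ℤ × {y : Fin l → ℤ // ∑ j, y j = 0}) :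
    ∑ j, sumZeroEquiv l x j = x.1 := by
  refine (sum_affineRotate_zpow x.1 (x.2 : Fin l → ℤ)).trans ?_
  rw [x.2.2, zero_add]

theorem residueForm_sumZeroEquiv (x : ℤ × {y : Fin l → ℤ // ∑ j, y j = 0}) :
    residueForm l (sumZeroEquiv l x) = residueForm l x.2 + tri x.1 := by
  have h := residueForm_sub_tri_affineRotate_zpow x.1 (x.2 : Fin l → ℤ)
  rw [x.2.2, show tri 0 = 0 from rfl, sub_zero, sub_eq_iff_eq_add] at h
  rw [← sum_sumZeroEquiv x]
  exact h

end AffineRotation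

section SumZeroTheta

variable {𝕜 : Type*} [NontriviallyNormedField 𝕜] [CompleteSpace 𝕜] {q : 𝕜}

theorem exists_qProd_mul_qProd_ne_zero (hq0 : q ≠ 0) (hq : ‖q‖ < 1) :
    ∃ w : 𝕜, w ≠ 0 ∧ qProd q w * qProd q (q * w⁻¹) ≠ 0 := by
  have hcountable : (insert 0 (Set.range fun n : ℤ => -q ^ n)).Countable :=
    (Set.countable_range _).insert 0
  obtain ⟨w, hw⟩ := (hcountable.dense_compl 𝕜).nonempty
  have hw0 : w ≠ 0 := fun h => hw (Or.inl h)
  have hwq (n : ℤ) : w + q ^ n ≠ 0 := fun h => hw (Or.inr ⟨n, (eq_neg_of_add_eq_zero_left h).symm⟩)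
  refine ⟨w, hw0, mul_ne_zero (qProd_ne_zero hq fun k hk => ?_) (qProd_ne_zero hq fun k hk => ?_)⟩
  · refine hwq (-k) ?_
    rw [zpow_neg, zpow_natCast]
    have := pow_ne_zero k hq0
    field_simp
    rw [add_comm, hk, mul_zero]
  · refine hwq (k + 1) ?_
    rw [zpow_add_one₀ hq0, zpow_natCast]
    field_simp at hk
    rwa [mul_zero, mul_comm q] at hk

/-- The sum-zero theta series is found by dividing the theta series of `ℤ ^ l` by that of `ℤ`, at
any `w` for which the latter does not vanish. -/
theorem hasAbsSum_residueForm_sum_zero (hq0 : q ≠ 0) (hq : ‖q‖ < 1) (l : ℕ) [NeZero l] :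
    HasAbsSum (fun y : {y : Fin l → ℤ // ∑ j, y j = 0} => q ^ residueForm l y)
      (eulerPhi (q ^ l) ^ l / eulerPhi q) := by
  obtain ⟨w, hw0, hw⟩ := exists_qProd_mul_qProd_ne_zero hq0 hq
  have hline := hasAbsSum_tripleProduct hq0 hq hw0
  have hlattice := hasAbsSum_residueForm hq0 hq hw0 l
  have hsummable : Summable fun y : {y : Fin l → ℤ // ∑ j, y j = 0} => ‖q ^ residueForm l y‖ :=
    (hlattice.summable_norm.comp_injective Subtype.val_injective).congr fun y => by
      rw [Function.comp_apply, y.2, zpow_zero, mul_one]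
  have hproduct := hline.mul ⟨hsummable, hsummable.of_norm.hasSum⟩
  have hterm (x : ℤ × {y : Fin l → ℤ // ∑ j, y j = 0}) :
      q ^ residueForm l (sumZeroEquiv l x) * w ^ ∑ j, sumZeroEquiv l x j =
        q ^ tri x.1 * w ^ x.1 * q ^ residueForm l x.2 := by
    rw [sum_sumZeroEquiv, residueForm_sumZeroEquiv, zpow_add₀ hq0]
    ring
  have heq := (((sumZeroEquiv l).hasSum_iff.2 hlattice.hasSum).congr_fun fun x =>
    (hterm x).symm).unique hproduct.hasSum
  refine ⟨hsummable, (eq_div_iff (eulerPhi_ne_zero hq)).2 (mul_right_cancel₀ hw ?_) ▸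
    hsummable.of_norm.hasSum⟩
  rw [heq]
  ring

end SumZeroTheta

/-! ### The change of variables -/

section Differences

variable {l : ℕ}

/-- Extension of a finite sequence by zero, so that sums over `Fin l` become telescoping sums over
`Finset.range l`. -/
def extendZero (k : Fin l → ℤ) (i : ℕ) : ℤ := if h : i < l then k ⟨i, h⟩ else 0

theorem extendZero_of_lt (k : Fin l → ℤ) {i : ℕ} (hi : i < l) : extendZero k i = k ⟨i, hi⟩ :=
  dif_pos hi

theorem extendZero_of_le (k : Fin l → ℤ) {i : ℕ} (hi : l ≤ i) : extendZero k i = 0 :=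
  dif_neg hi.not_gt

variable (l) in
/-- The change of variables `d i = k (i + 1) - k i`, where `k l = 0`. -/
def diffEquiv : (Fin l → ℤ) ≃ (Fin l → ℤ) where
  toFun k i := extendZero k (i + 1) - extendZero k i
  invFun d i := -∑ j ∈ Finset.Ico (i : ℕ) l, extendZero d j
  left_inv k := by
    funext i
    have hextend (j : ℕ) (hj : j ∈ Finset.Ico (i : ℕ) l) :
        extendZero (fun i : Fin l => extendZero k (i + 1) - extendZero k i) j =
          extendZero k (j + 1) - extendZero k j := extendZero_of_lt _ (Finset.mem_Ico.1 hj).2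
    dsimp only
    rw [Finset.sum_congr rfl hextend, Finset.sum_Ico_sub _ i.2.le, extendZero_of_le k le_rfl,
      extendZero_of_lt k i.2, zero_sub, neg_neg]
  right_inv d := by
    have hextend {t : ℕ} (ht : t ≤ l) :
        extendZero (fun i : Fin l => -∑ j ∈ Finset.Ico (i : ℕ) l, extendZero d j) t =
          -∑ j ∈ Finset.Ico t l, extendZero d j := by
      rcases ht.eq_or_lt with rfl | ht
      · rw [extendZero_of_le _ le_rfl, Finset.Ico_self, Finset.sum_empty, neg_zero]
      · exact extendZero_of_lt _ ht
    funext i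
    dsimp only
    rw [hextend i.2, hextend i.2.le, Finset.sum_eq_sum_Ico_succ_bot i.2, extendZero_of_lt d i.2]
    ring

theorem diffEquiv_apply (k : Fin l → ℤ) (i : Fin l) :
    diffEquiv l k i = extendZero k (i + 1) - extendZero k i := rfl

theorem sum_diffEquiv (k : Fin l → ℤ) : ∑ i, diffEquiv l k i = -extendZero k 0 := by
  simp only [diffEquiv_apply]
  rw [Fin.sum_univ_eq_sum_range (fun i => extendZero k (i + 1) - extendZero k i),
    Finset.sum_range_sub, extendZero_of_le k le_rfl, zero_sub]

theorem kappa_eq_sum_range (k : Fin l → ℤ) :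
    kappa k =
      ∑ i ∈ Finset.range l, (extendZero k i ^ 2 - extendZero k i * extendZero k (i + 1)) := by
  have hsq : ∑ i, k i ^ 2 = ∑ i ∈ Finset.range l, extendZero k i ^ 2 := by
    rw [← Fin.sum_univ_eq_sum_range (fun i => extendZero k i ^ 2)]
    exact Finset.sum_congr rfl fun i _ => by rw [extendZero_of_lt k i.2]
  have hmul : ∑ i : Fin (l - 1), k ⟨i.val, by lia⟩ * k ⟨i.val + 1, by lia⟩ =
      ∑ i ∈ Finset.range (l - 1), extendZero k i * extendZero k (i + 1) := by
    rw [← Fin.sum_univ_eq_sum_range (fun i => extendZero k i * extendZero k (i + 1))]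
    exact Finset.sum_congr rfl fun i _ => by
      rw [extendZero_of_lt k (by lia), extendZero_of_lt k (by lia)]
  have hlast : ∑ i ∈ Finset.range (l - 1), extendZero k i * extendZero k (i + 1) =
      ∑ i ∈ Finset.range l, extendZero k i * extendZero k (i + 1) :=
    Finset.sum_subset (Finset.range_mono l.pred_le) fun i _ hi => by
      rw [extendZero_of_le k (i := i + 1) (by simp at hi; lia), mul_zero]
  rw [kappa, hsq, hmul, hlast, Finset.sum_sub_distrib]

theorem tri_sub (a b : ℤ) : tri (b - a) = a ^ 2 - a * b + (tri b - tri a) := by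
  linarith [two_mul_tri (b - a), two_mul_tri a, two_mul_tri b]

theorem kappa_eq (k : Fin l → ℤ) : kappa k = ∑ i, tri (diffEquiv l k i) + tri (extendZero k 0) := by
  simp only [diffEquiv_apply, tri_sub]
  rw [Fin.sum_univ_eq_sum_range (fun i => extendZero k i ^ 2 - extendZero k i * extendZero k (i + 1)
      + (tri (extendZero k (i + 1)) - tri (extendZero k i))),
    Finset.sum_add_distrib, Finset.sum_range_sub (fun i => tri (extendZero k i)),
    ← kappa_eq_sum_range, extendZero_of_le k le_rfl, show tri 0 = 0 from rfl]
  ring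

theorem sum_range_sub_mul (a b : ℕ → ℤ) (n : ℕ) :
    ∑ i ∈ Finset.range n, (a i - a (i + 1)) * b i =
      ∑ i ∈ Finset.range n, a (i + 1) * (b (i + 1) - b i) + a 0 * b 0 - a n * b n := by
  rw [add_sub_assoc, ← Finset.sum_range_sub' fun i => a i * b i, ← Finset.sum_add_distrib]
  exact Finset.sum_congr rfl fun i _ => by ring

end Differences

section GaussExponent

variable {m : ℕ}

/-- A sequence with consecutive differences `-linCoeff m`, used to sum `lin` by parts. Its values
after the first one are a cyclic shift of the coefficients of `residueForm (4 * m - 1)`. -/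
def linPotential (m : ℕ) : ℕ → ℤ
  | 0 => 3 * m - 1
  | i + 1 => ((i + m) % (4 * m - 1) : ℕ)

theorem linPotential_succ_of_lt {i : ℕ} (hi : i + m < 4 * m - 1) :
    linPotential m (i + 1) = i + m := by
  rw [linPotential, Nat.mod_eq_of_lt hi, Nat.cast_add]

theorem linPotential_succ_of_le {i : ℕ} (hi : i < 4 * m - 1) (him : 4 * m - 1 ≤ i + m) :
    linPotential m (i + 1) = i + m - (4 * m - 1) := by
  rw [linPotential, Nat.mod_eq_sub_mod him, Nat.mod_eq_of_lt (by lia)]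
  lia

theorem linCoeff_eq_sub (i : Fin (4 * m - 1)) :
    linCoeff m i = linPotential m i - linPotential m (i + 1) := by
  obtain ⟨i, hi⟩ := i
  rw [linCoeff]
  rcases i with _ | i
  · rw [linPotential_succ_of_lt (by lia)]
    simp [linPotential]
    ring
  · rcases lt_trichotomy (i + 1 + m) (4 * m - 1) with him | him | him
    · rw [linPotential_succ_of_lt him, linPotential_succ_of_lt (by lia)]
      split_ifs <;> push_cast <;> lia
    · rw [linPotential_succ_of_le hi him.ge, linPotential_succ_of_lt (by lia)]
      split_ifs <;> push_cast <;> lia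
    · rw [linPotential_succ_of_le hi him.le, linPotential_succ_of_le (by lia) (by lia)]
      split_ifs <;> push_cast <;> lia

theorem lin_eq (k : Fin (4 * m - 1) → ℤ) :
    lin m k = ∑ i : Fin (4 * m - 1), (((i + m) % (4 * m - 1) : ℕ) : ℤ) * diffEquiv _ k i +
      (3 * m - 1) * extendZero k 0 := by
  have hlin : lin m k = ∑ i ∈ Finset.range (4 * m - 1),
      (linPotential m i - linPotential m (i + 1)) * extendZero k i := by
    rw [← Fin.sum_univ_eq_sum_range
      (fun i => (linPotential m i - linPotential m (i + 1)) * extendZero k i)]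
    exact Finset.sum_congr rfl fun i _ => by rw [linCoeff_eq_sub, extendZero_of_lt k i.2]
  rw [hlin, sum_range_sub_mul, extendZero_of_le k le_rfl, mul_zero, sub_zero,
    ← Fin.sum_univ_eq_sum_range
      (fun i => linPotential m (i + 1) * (extendZero k (i + 1) - extendZero k i))]
  rfl

variable [NeZero m]

instance neZero_four_mul_sub_one : NeZero (4 * m - 1) :=
  ⟨by have := NeZero.pos m; lia⟩

variable (m) in
/-- The coordinates `y (i + m) = k (i + 1) - k i`, with indices modulo `4 * m - 1`, in which
`gaussExponent m` becomes `residueForm (4 * m - 1)` up to a polynomial in `∑ y`. -/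
def gaussEquiv : (Fin (4 * m - 1) → ℤ) ≃ (Fin (4 * m - 1) → ℤ) :=
  (diffEquiv _).trans
    ((Equiv.addRight (Fin.ofNat (4 * m - 1) m)).arrowCongr (Equiv.refl ℤ))

theorem gaussEquiv_add (k : Fin (4 * m - 1) → ℤ) (i : Fin (4 * m - 1)) :
    gaussEquiv m k (i + Fin.ofNat _ m) = diffEquiv _ k i := by
  simp [gaussEquiv, Equiv.arrowCongr]

theorem sum_gaussEquiv (k : Fin (4 * m - 1) → ℤ) : ∑ j, gaussEquiv m k j = -extendZero k 0 := by
  rw [← sum_diffEquiv, ← Equiv.sum_comp (Equiv.addRight (Fin.ofNat (4 * m - 1) m))]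
  exact Finset.sum_congr rfl fun i _ => gaussEquiv_add k i

theorem residueForm_gaussEquiv (k : Fin (4 * m - 1) → ℤ) :
    residueForm (4 * m - 1) (gaussEquiv m k) = (4 * m - 1) * ∑ i, tri (diffEquiv _ k i) +
      ∑ i : Fin (4 * m - 1), (((i + m) % (4 * m - 1) : ℕ) : ℤ) * diffEquiv _ k i := by
  have hcast : ((4 * m - 1 : ℕ) : ℤ) = 4 * m - 1 := by
    have := NeZero.pos m
    lia
  rw [residueForm, ← Equiv.sum_comp (Equiv.addRight (Fin.ofNat (4 * m - 1) m)), Finset.mul_sum,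
    ← Finset.sum_add_distrib]
  refine Finset.sum_congr rfl fun i _ => ?_
  rw [Equiv.coe_addRight, gaussEquiv_add, hcast, Fin.val_add, Fin.val_ofNat, Nat.add_mod_mod]

theorem gaussExponent_eq (k : Fin (4 * m - 1) → ℤ) :
    gaussExponent m k = residueForm (4 * m - 1) (gaussEquiv m k) - tri (∑ j, gaussEquiv m k j) +
      m * (2 * (∑ j, gaussEquiv m k j) ^ 2 - ∑ j, gaussEquiv m k j) := by
  rw [gaussExponent, kappa_eq, lin_eq, residueForm_gaussEquiv, sum_gaussEquiv, tri_neg]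
  linear_combination 2 * (m : ℤ) * two_mul_tri (extendZero k 0)

variable (m) in
/-- Parametrization of `ℤ ^ (4 * m - 1)` by `ℤ` and the sum-zero lattice which separates the
variables of `gaussExponent m`. -/
def gaussParam : ℤ × {y : Fin (4 * m - 1) → ℤ // ∑ j, y j = 0} ≃ (Fin (4 * m - 1) → ℤ) :=
  (sumZeroEquiv (4 * m - 1)).trans (gaussEquiv m).symm

theorem gaussExponent_gaussParam (x : ℤ × {y : Fin (4 * m - 1) → ℤ // ∑ j, y j = 0}) :
    gaussExponent m (gaussParam m x) = m * (2 * x.1 ^ 2 - x.1) + residueForm (4 * m - 1) x.2 := by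
  rw [gaussExponent_eq, gaussParam, Equiv.trans_apply, Equiv.apply_symm_apply, sum_sumZeroEquiv,
    residueForm_sumZeroEquiv]
  ring

theorem gaussExponent_nonneg (k : Fin (4 * m - 1) → ℤ) : 0 ≤ gaussExponent m k := by
  obtain ⟨x, rfl⟩ := (gaussParam m).surjective k
  have hsq : 0 ≤ 2 * x.1 ^ 2 - x.1 := by rcases le_or_gt x.1 0 with h | h <;> nlinarith
  rw [gaussExponent_gaussParam]
  exact add_nonneg (mul_nonneg (Int.natCast_nonneg m) hsq) (residueForm_nonneg _)

theorem hasAbsSum_gaussExponent {𝕜 : Type*} [NontriviallyNormedField 𝕜] [CompleteSpace 𝕜] {q : 𝕜}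
    (hq0 : q ≠ 0) (hq : ‖q‖ < 1) :
    HasAbsSum (fun k => q ^ gaussExponent m k)
      (eulerPhi (q ^ (4 * m - 1)) ^ (4 * m - 1) * eulerPhi (q ^ (2 * m)) ^ 2 /
        (eulerPhi q * eulerPhi (q ^ m))) := by
  have hgauss := hasAbsSum_gauss (pow_ne_zero m hq0) (norm_pow_lt_one hq (NeZero.ne m))
  have hprod := hgauss.mul (hasAbsSum_residueForm_sum_zero hq0 hq (4 * m - 1))
  rw [← HasAbsSum.equiv_iff (gaussParam m)]
  convert hprod using 1
  · funext x
    rw [Function.comp_apply, gaussExponent_gaussParam, zpow_add₀ hq0, zpow_mul, zpow_natCast]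
  · rw [← pow_mul, mul_comm m 2, div_mul_div_comm, mul_comm (eulerPhi (q ^ (2 * m)) ^ 2),
      mul_comm (eulerPhi q)]

end GaussExponent

/-! ### Evaluation of formal power series -/

section Evaluation

variable {𝕜 : Type*}

/-- The power series `f` converges absolutely at `q`, with sum `v`. -/
def HasEvalAt [NormedField 𝕜] (f : PowerSeries 𝕜) (q v : 𝕜) : Prop :=
  HasAbsSum (fun n => PowerSeries.coeff n f * q ^ n) v

namespace HasEvalAt

section NormedField

variable [NormedField 𝕜] {f g : PowerSeries 𝕜} {q u v : 𝕜}

theorem one (q : 𝕜) : HasEvalAt 1 q 1 := by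
  have hsingle := HasAbsSum.single (f := fun n => PowerSeries.coeff n (1 : PowerSeries 𝕜) * q ^ n) 0
    fun n hn => by rw [PowerSeries.coeff_one, if_neg hn, zero_mul]
  simpa [HasEvalAt] using hsingle

theorem zero_right (f : PowerSeries 𝕜) : HasEvalAt f 0 (PowerSeries.constantCoeff f) := by
  have hsingle := HasAbsSum.single (f := fun n => PowerSeries.coeff n f * (0 : 𝕜) ^ n) 0
    fun n hn => by rw [zero_pow hn, mul_zero]
  simpa [HasEvalAt] using hsingle

theorem constantCoeff_eq (h : HasEvalAt f 0 v) : PowerSeries.constantCoeff f = v :=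
  (zero_right f).hasSum.unique h.hasSum

theorem sub (hf : HasEvalAt f q u) (hg : HasEvalAt g q v) : HasEvalAt (f - g) q (u - v) := by
  have hcoeff (n : ℕ) : PowerSeries.coeff n (f - g) * q ^ n =
      PowerSeries.coeff n f * q ^ n - PowerSeries.coeff n g * q ^ n := by
    rw [map_sub, sub_mul]
  simp only [HasEvalAt, hcoeff]
  exact ⟨(hf.summable_norm.add hg.summable_norm).of_nonneg_of_le (fun _ => norm_nonneg _)
    fun _ => norm_sub_le _ _, hf.hasSum.sub hg.hasSum⟩

theorem of_hasSum_monomial {ι : Type*} {c : ι → 𝕜} {e : ι → ℕ}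
    (hf : HasSum (fun i => PowerSeries.monomial (e i) (c i)) f)
    (hq : HasAbsSum (fun i => c i * q ^ e i) v) : HasEvalAt f q v := by
  refine hq.fiberwise e fun n => ?_
  have hcoeff := ((PowerSeries.WithPiTopology.hasSum_iff_hasSum_coeff 𝕜).1 hf n).mul_right (q ^ n)
  have hsupport : Function.support (fun i =>
      PowerSeries.coeff n (PowerSeries.monomial (e i) (c i)) * q ^ n) ⊆ {i | e i = n} := by
    refine fun i hi => by_contra fun hne => hi ?_
    dsimp only
    rw [PowerSeries.coeff_monomial, if_neg (Ne.symm hne), zero_mul]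
  refine ((hasSum_subtype_iff_of_support_subset hsupport).2 hcoeff).congr_fun fun ⟨i, hi⟩ => ?_
  subst hi
  rw [Function.comp_apply, PowerSeries.coeff_monomial_same]

theorem mul [CompleteSpace 𝕜] (hf : HasEvalAt f q u) (hg : HasEvalAt g q v) :
    HasEvalAt (f * g) q (u * v) := by
  have hcoeff (n : ℕ) : PowerSeries.coeff n (f * g) * q ^ n =
      ∑ x ∈ Finset.HasAntidiagonal.antidiagonal n,
        PowerSeries.coeff x.1 f * q ^ x.1 * (PowerSeries.coeff x.2 g * q ^ x.2) := by
    rw [PowerSeries.coeff_mul, Finset.sum_mul]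
    refine Finset.sum_congr rfl fun x hx => ?_
    rw [← Finset.HasAntidiagonal.mem_antidiagonal.1 hx, pow_add]
    ring
  have hnorm := summable_norm_sum_mul_antidiagonal_of_summable_norm hf.summable_norm
    hg.summable_norm
  simp only [HasEvalAt, hcoeff]
  refine ⟨hnorm, ?_⟩
  rw [← hf.hasSum.tsum_eq, ← hg.hasSum.tsum_eq,
    tsum_mul_tsum_eq_tsum_sum_antidiagonal_of_summable_norm hf.summable_norm hg.summable_norm]
  exact hnorm.of_norm.hasSum

theorem pow [CompleteSpace 𝕜] (hf : HasEvalAt f q u) (n : ℕ) : HasEvalAt (f ^ n) q (u ^ n) := by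
  induction n with
  | zero => simpa only [pow_zero] using one q
  | succ n ih => simpa only [pow_succ] using ih.mul hf

end NormedField

theorem eq_zero_of_punctured_ball [NontriviallyNormedField 𝕜] {f : PowerSeries 𝕜}
    (hf : ∀ q, q ≠ 0 → ‖q‖ < 1 → HasEvalAt f q 0) : f = 0 := by
  let F (q : 𝕜) : 𝕜 := ∑' n, PowerSeries.coeff n f * q ^ n
  let p : FormalMultilinearSeries 𝕜 𝕜 𝕜 := .ofScalars 𝕜 fun n => PowerSeries.coeff n f
  have hcoeff (n : ℕ) : p.coeff n = PowerSeries.coeff n f :=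
    FormalMultilinearSeries.coeff_ofScalars
  have hball : Metric.ball (0 : 𝕜) 1 ∈ 𝓝 0 := Metric.ball_mem_nhds 0 one_pos
  have hF : HasFPowerSeriesAt F p 0 := by
    rw [hasFPowerSeriesAt_iff]
    filter_upwards [hball] with q hq
    simp only [hcoeff, zero_add, smul_eq_mul, mul_comm (q ^ _)]
    rcases eq_or_ne q 0 with rfl | hq0
    · exact (zero_right f).hasSum.summable.hasSum
    · exact (hf q hq0 (mem_ball_zero_iff.1 hq)).hasSum.summable.hasSum
  have hF0 : ∀ᶠ q in 𝓝[≠] (0 : 𝕜), F q = 0 := by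
    filter_upwards [self_mem_nhdsWithin, nhdsWithin_le_nhds hball] with q hq0 hq
    exact (hf q hq0 (mem_ball_zero_iff.1 hq)).hasSum.tsum_eq
  have hp : p = 0 := by
    by_contra hp
    obtain ⟨q, hq, hq'⟩ := (hF0.and (hF.locally_ne_zero hp)).exists
    exact hq' hq
  ext n
  rw [← hcoeff, hp, map_zero]
  rfl

theorem eq_of_punctured_ball [NontriviallyNormedField 𝕜] {f g : PowerSeries 𝕜} {F : 𝕜 → 𝕜}
    (hf : ∀ q, q ≠ 0 → ‖q‖ < 1 → HasEvalAt f q (F q))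
    (hg : ∀ q, q ≠ 0 → ‖q‖ < 1 → HasEvalAt g q (F q)) : f = g :=
  sub_eq_zero.1 <| eq_zero_of_punctured_ball fun q hq0 hq => by
    simpa only [sub_self] using (hf q hq0 hq).sub (hg q hq0 hq)

end HasEvalAt

theorem prod_neg_pow_pow {R : Type*} [CommRing R] (x : R) (a : ℕ) (s : Finset ℕ) :
    ∏ j ∈ s, -(x ^ a) ^ (j + 1) = (-1) ^ s.card * x ^ (∑ j ∈ s, a * (j + 1)) := by
  rw [Finset.prod_neg, Finset.prod_pow_eq_pow_sum, ← pow_mul, Finset.mul_sum]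

theorem hasSum_eulerPhi_X_pow {R : Type*} [CommRing R] [TopologicalSpace R] [IsTopologicalRing R]
    [T2Space R] [Nontrivial R] {a : ℕ} (ha : a ≠ 0) :
    HasSum (fun s : Finset ℕ => ∏ j ∈ s, -((PowerSeries.X : PowerSeries R) ^ a) ^ (j + 1))
      (eulerPhi (PowerSeries.X ^ a)) := by
  have hsum : Summable fun s : Finset ℕ =>
      ∏ j ∈ s, -((PowerSeries.X : PowerSeries R) ^ a) ^ (j + 1) := by
    refine PowerSeries.WithPiTopology.summable_prod_of_tendsto_order_atTop_nhds_top R ?_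
    simp_rw [PowerSeries.order_neg, ← pow_mul, PowerSeries.order_X_pow]
    refine ENat.tendsto_natCast_nhds_top.comp (tendsto_atTop_mono (fun j => ?_) tendsto_id)
    exact (Nat.le_succ j).trans (Nat.le_mul_of_pos_left _ (Nat.pos_of_ne_zero ha))
  simp only [eulerPhi, sub_eq_add_neg, tprod_one_add hsum]
  exact hsum.hasSum

theorem hasAbsSum_eulerPhi [NormedField 𝕜] [CompleteSpace 𝕜] {q : 𝕜} (hq : ‖q‖ < 1) :
    HasAbsSum (fun s : Finset ℕ => ∏ j ∈ s, -q ^ (j + 1)) (eulerPhi q) := by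
  have hnorm : Summable fun j => ‖-q ^ (j + 1)‖ := by
    simpa only [norm_neg, pow_succ'] using summable_norm_mul_pow hq q
  have hsum := summable_finsetProd_of_summable_norm hnorm
  simp only [eulerPhi, sub_eq_add_neg, tprod_one_add hsum]
  refine ⟨?_, hsum.hasSum⟩
  simpa only [norm_prod] using summable_finsetProd_of_summable_norm hnorm.norm

theorem hasEvalAt_eulerPhi [NormedField 𝕜] [CompleteSpace 𝕜] {a : ℕ} (ha : a ≠ 0) {q : 𝕜}
    (hq : ‖q‖ < 1) : HasEvalAt (eulerPhi (PowerSeries.X ^ a)) q (eulerPhi (q ^ a)) := by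
  have hformal := hasSum_eulerPhi_X_pow (R := 𝕜) ha
  have hvalue := hasAbsSum_eulerPhi (norm_pow_lt_one hq ha)
  simp only [prod_neg_pow_pow] at hformal hvalue
  refine .of_hasSum_monomial (hformal.congr_fun fun s => ?_) hvalue
  rw [PowerSeries.monomial_eq_C_mul_X_pow, map_pow, map_neg, map_one]

end Evaluation

section Transfer

variable {𝕜 ι : Type*} {e : ι → ℕ}

theorem summable_X_pow [NormedField 𝕜] {q : 𝕜} (hq0 : q ≠ 0) (h : Summable fun i => q ^ e i) :
    Summable fun i => (PowerSeries.X : PowerSeries 𝕜) ^ e i := by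
  rw [PowerSeries.WithPiTopology.summable_iff_summable_coeff]
  intro n
  have hsmall : ∀ᶠ i in cofinite, ‖q ^ e i‖ < ‖q ^ n‖ := by
    have htendsto := h.tendsto_cofinite_zero.norm
    rw [norm_zero] at htendsto
    exact htendsto.eventually_lt_const (norm_pos_iff.2 (pow_ne_zero n hq0))
  refine summable_of_hasFiniteSupport (hsmall.subset fun i hi (hlt : ‖q ^ e i‖ < ‖q ^ n‖) => hi ?_)
  dsimp only
  rw [PowerSeries.coeff_X_pow, if_neg]
  rintro rfl
  exact hlt.false

variable [NontriviallyNormedField 𝕜] [CompleteSpace 𝕜] {N D : PowerSeries 𝕜} {n d : 𝕜 → 𝕜}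

theorem hasSum_X_pow_of_hasAbsSum (hN : ∀ q, ‖q‖ < 1 → HasEvalAt N q (n q))
    (hD : ∀ q, ‖q‖ < 1 → HasEvalAt D q (d q)) (hd : ∀ q, ‖q‖ < 1 → d q ≠ 0)
    (h : ∀ q, q ≠ 0 → ‖q‖ < 1 → HasAbsSum (fun i => q ^ e i) (n q / d q)) :
    HasSum (fun i => (PowerSeries.X : PowerSeries 𝕜) ^ e i) (N * D⁻¹) := by
  obtain ⟨q₀, hpos, hlt⟩ := NormedField.exists_norm_lt_one 𝕜
  have hne : q₀ ≠ 0 := norm_pos_iff.1 hpos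
  obtain ⟨P, hP⟩ := summable_X_pow hne (h q₀ hne hlt).hasSum.summable
  have hPeval (q : 𝕜) (hq0 : q ≠ 0) (hq : ‖q‖ < 1) : HasEvalAt P q (n q / d q) :=
    .of_hasSum_monomial (c := fun _ => 1) (by simpa only [PowerSeries.X_pow_eq] using hP)
      (by simpa only [one_mul] using h q hq0 hq)
  have hPD : P * D = N := HasEvalAt.eq_of_punctured_ball
    (fun q hq0 hq => (hPeval q hq0 hq).mul (hD q hq)) fun q _ hq => by
      rw [div_mul_cancel₀ _ (hd q hq)]
      exact hN q hq
  have hD0 : PowerSeries.constantCoeff D ≠ 0 := by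
    rw [(hD 0 (by simp)).constantCoeff_eq]
    exact hd 0 (by simp)
  rwa [← hPD, mul_assoc, PowerSeries.mul_inv_cancel D hD0, mul_one]

theorem hasAbsSum_pow_of_punctured_ball (hN : ∀ q, ‖q‖ < 1 → HasEvalAt N q (n q))
    (hD : ∀ q, ‖q‖ < 1 → HasEvalAt D q (d q)) (hd : ∀ q, ‖q‖ < 1 → d q ≠ 0)
    (h : ∀ q, q ≠ 0 → ‖q‖ < 1 → HasAbsSum (fun i => q ^ e i) (n q / d q)) {q : 𝕜}
    (hq : ‖q‖ < 1) : HasAbsSum (fun i => q ^ e i) (n q / d q) := by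
  rcases ne_or_eq q 0 with hq0 | rfl
  · exact h q hq0 hq
  obtain ⟨q₀, hpos, hlt⟩ := NormedField.exists_norm_lt_one 𝕜
  have hzero (i : ι) : (0 : 𝕜) ^ e i = PowerSeries.coeff 0 (PowerSeries.X ^ e i) := by
    rw [PowerSeries.coeff_zero_eq_constantCoeff_apply, map_pow, PowerSeries.constantCoeff_X]
  refine ⟨(h q₀ (norm_pos_iff.1 hpos) hlt).summable_norm.of_nonneg_of_le (fun _ => norm_nonneg _)
    fun i => ?_, ?_⟩
  · rw [norm_pow, norm_pow, norm_zero]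
    exact pow_le_pow_left₀ le_rfl hpos.le _
  · have hcoeff := (PowerSeries.WithPiTopology.hasSum_iff_hasSum_coeff 𝕜).1
      (hasSum_X_pow_of_hasAbsSum hN hD hd h) 0
    simpa only [← hzero, PowerSeries.coeff_zero_eq_constantCoeff_apply, map_mul,
      PowerSeries.constantCoeff_inv, (hN 0 hq).constantCoeff_eq, (hD 0 hq).constantCoeff_eq,
      ← div_eq_mul_inv] using hcoeff

end Transfer

theorem mainTheorem1_general {𝕜 : Type*} [NontriviallyNormedField 𝕜] [CompleteSpace 𝕜] (m : ℕ)
    (hm : 0 < m) :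
    (∃ e : (Fin (4 * m - 1) → ℤ) → ℕ,
      (∀ k, (e k : ℤ) = gaussExponent m k) ∧
      HasSum (fun k : Fin (4 * m - 1) → ℤ => (PowerSeries.X : PowerSeries 𝕜) ^ e k)
        (eulerPhi ((PowerSeries.X : PowerSeries 𝕜) ^ (4 * m - 1)) ^ (4 * m - 1) *
            eulerPhi ((PowerSeries.X : PowerSeries 𝕜) ^ (2 * m)) ^ 2 *
          (eulerPhi (PowerSeries.X : PowerSeries 𝕜) *
            eulerPhi ((PowerSeries.X : PowerSeries 𝕜) ^ m))⁻¹)) ∧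
    (∀ q : 𝕜, ‖q‖ < 1 →
      HasAbsSum (fun k : Fin (4 * m - 1) → ℤ => q ^ gaussExponent m k)
        (eulerPhi (q ^ (4 * m - 1)) ^ (4 * m - 1) * eulerPhi (q ^ (2 * m)) ^ 2 /
          (eulerPhi q * eulerPhi (q ^ m)))) := by
  have : NeZero m := ⟨hm.ne'⟩
  obtain ⟨e, he⟩ : ∃ e : (Fin (4 * m - 1) → ℤ) → ℕ, ∀ k, (e k : ℤ) = gaussExponent m k :=
    ⟨fun k => (gaussExponent m k).toNat, fun k => Int.toNat_of_nonneg (gaussExponent_nonneg k)⟩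
  have hsum (q : 𝕜) (hq0 : q ≠ 0) (hq : ‖q‖ < 1) := hasAbsSum_gaussExponent (m := m) hq0 hq
  have hnum (q : 𝕜) (hq : ‖q‖ < 1) :=
    ((hasEvalAt_eulerPhi (NeZero.ne (4 * m - 1)) hq).pow (4 * m - 1)).mul
      ((hasEvalAt_eulerPhi (NeZero.ne (2 * m)) hq).pow 2)
  have hden (q : 𝕜) (hq : ‖q‖ < 1) :=
    (hasEvalAt_eulerPhi one_ne_zero hq).mul (hasEvalAt_eulerPhi hm.ne' hq)
  have hden0 (q : 𝕜) (hq : ‖q‖ < 1) : eulerPhi q * eulerPhi (q ^ m) ≠ 0 :=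
    mul_ne_zero (eulerPhi_ne_zero hq) (eulerPhi_ne_zero (norm_pow_lt_one hq hm.ne'))
  simp only [← he, zpow_natCast, pow_one] at hsum hden ⊢
  exact ⟨⟨e, fun _ => rfl, hasSum_X_pow_of_hasAbsSum hnum hden hden0 hsum⟩,
    fun q hq => hasAbsSum_pow_of_punctured_ball hnum hden hden0 hsum hq⟩

/-- The identity holds in `ℂ⟦q⟧` (all exponents being natural numbers `e k`), and also
for every complex number `q` in the open unit disc, with unconditional convergence. -/
theorem mainTheorem1 (m : ℕ) (hm : 0 < m) :
    (∃ e : (Fin (4 * m - 1) → ℤ) → ℕ,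
      (∀ k, (e k : ℤ) = gaussExponent m k) ∧
      HasSum (fun k : Fin (4 * m - 1) → ℤ => (PowerSeries.X : PowerSeries ℂ) ^ e k)
        (eulerPhi ((PowerSeries.X : PowerSeries ℂ) ^ (4 * m - 1)) ^ (4 * m - 1) *
            eulerPhi ((PowerSeries.X : PowerSeries ℂ) ^ (2 * m)) ^ 2 *
          (eulerPhi (PowerSeries.X : PowerSeries ℂ) *
            eulerPhi ((PowerSeries.X : PowerSeries ℂ) ^ m))⁻¹)) ∧
    (∀ q : ℂ, ‖q‖ < 1 →
      HasSum (fun k : Fin (4 * m - 1) → ℤ => q ^ gaussExponent m k)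
        (eulerPhi (q ^ (4 * m - 1)) ^ (4 * m - 1) * eulerPhi (q ^ (2 * m)) ^ 2 /
          (eulerPhi q * eulerPhi (q ^ m)))) := by
  obtain ⟨hformal, hanalytic⟩ := mainTheorem1_general (𝕜 := ℂ) m hm
  exact ⟨hformal, fun q hq => (hanalytic q hq).hasSum⟩
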